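/- Let $m,q\ge 0$ be integers, let $X=\{x_0,x_1,\dots,x_m\}$ be an alphabet of noncommuting letters and $\tilde X=\{\tilde x_1,\dots,\tilde x_q\}$ a set of commuting letters. For $k \ge 0$ let $\mathbb{R}^k\langle\langle X\rangle\rangle$ be the set of maps $c:X^*\to\mathbb{R}^k$, $\eta\mapsto(c,\eta)$, where $X^*$ is the set of words over $X$ with empty word $\emptyset$, and let $\mathbb{R}^k[[\tilde X]]$ be the set of $k$-tuples of real formal power series in the commuting variables $\tilde x_1,\dots,\tilde x_q$. A series $c$ is called proper if $(c,\emptyset)=0$, and purely improper if each of its components has a nonzero constant term. Let $\sqcup\!\sqcup$ be the shuffle product: the bilinear product on scalar series determined on words by $\eta\mathbin{\sqcup\!\sqcup} \emptyset=\emptyset\mathbin{\sqcup\!\sqcup} \eta=\eta$ and $(x_i\eta)\mathbin{\sqcup\!\sqcup} (x_j\xi)=x_i(\eta\mathbin{\sqcup\!\sqcup} x_j\xi)+x_j(x_i\eta\mathbin{\sqcup\!\sqcup} \xi)$; it acts componentwise on vector-valued series. For $w\in\mathbb{R}^m\langle\langle X\rangle\rangle$ write $\delta_{w}$ for the formal symbol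 $\delta\mathbin{\sqcup\!\sqcup} w$, where $\delta$ stands for the identity operator. Define the following products. * For $c\in\mathbb{R}^k\langle\langle X\rangle\rangle$ and $w\in\mathbb{R}^m\langle\langle X\rangle\rangle$, the multiplicative mixed composition product is $c\,\tilde\circ\,\delta_{w}=\sum_{\eta\in X^*}(c,\eta)\,\bar\phi_w(\eta)(1)$, where $\bar\phi_w(\emptyset)=\mathrm{id}$, $\bar\phi_w(x_i\eta)=\bar\phi_w(x_i)\circ\bar\phi_w(\eta)$, $\bar\phi_w(x_0)(e)=x_0e$ and $\bar\phi_w(x_i)(e)=x_i(w_i\mathbin{\sqcup\!\sqcup} e)$ for $1\le i\le m$. * For $d\in\mathbb{R}^k[[\tilde X]]$ and a proper $c\in\mathbb{R}^q\langle\langle X\rangle\rangle$, the Wiener–Fliess composition product is $d\diamond c=\sum_{\tilde\eta}(d,\tilde\eta)\,c^{\sqcup\!\sqcup\,\tilde\eta}$, summed over the monomials $\tilde\eta$ in the commuting letters, where $c^{\sqcup\!\sqcup\,\emptyset}=1$ and $c^{\sqcup\!\sqcup\,\tilde x_i\tilde\eta}=c_i\mathbin{\sqcup\!\sqcup} c^{\sqcup\!\sqcup\,\tilde\eta}$.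 * For $f,g\in\mathbb{R}^m\langle\langle X\rangle\rangle$, $\delta_{f}\circ\delta_{g}=\delta_{h}$ with $h=g\mathbin{\sqcup\!\sqcup} (f\,\tilde\circ\,\delta_{g})$. The identity element is $\delta_{\mathbf 1}$, with $\mathbf 1=[1\,\cdots\,1]^t$. When $\delta_{f}$ has a unique two-sided inverse for this product, that inverse is written $\delta_{f^{\circ-1}}$. Theorem. Let $c\in\mathbb{R}^q\langle\langle X\rangle\rangle$ be proper and let $d\in\mathbb{R}^m[[\tilde X]]$ be purely improper, with componentwise multiplicative (Cauchy) inverse $d^{-1}$. Then $d^{-1}\diamond c$ is purely improper and $\delta_{(d^{-1}\diamond c)}$ has a unique two-sided inverse, so that $(d^{-1}\diamond c)^{\circ-1}$ is well defined. The series $$c\,\tilde\circ\,\delta_{(d^{-1}\diamond c)^{\circ-1}}$$ is proper, and it is the unique fixed point, among the proper series $e\in\mathbb{R}^q\langle\langle X\rangle\rangle$, of the map $e\mapsto c\,\tilde\circ\,\delta_{(d\diamond e)}$. -/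

import Mathlib

namespace ChenFliess

noncomputable section

/-- Words over the alphabet `X = {x_0, x_1, …, x_m}`; the letter `x_i` is `i : Fin (m + 1)`. -/
abbrev Word (m : ℕ) : Type := List (Fin (m + 1))

/-- Scalar formal power series over `X`: the coefficient of the word `η` in `c` is `c η`. -/
abbrev Series (m : ℕ) : Type := Word m → ℝ

/-- Vector-valued series `ℝ^k⟨⟨X⟩⟩`, given by their `k` components. -/
abbrev VSeries (m k : ℕ) : Type := Fin k → Series m

/-- `c` is proper: the coefficient `(c, ∅) ∈ ℝ^k` vanishes. -/
def IsProper {m k : ℕ} (c : VSeries m k) : Prop := ∀ i, c i [] = 0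

/-- `c` is purely improper: every component has a nonzero constant term. -/
def IsPurelyImproper {m k : ℕ} (c : VSeries m k) : Prop := ∀ i, c i [] ≠ 0

/-- A commutative series `d ∈ ℝ^k[[X̃]]` is purely improper: every component has a nonzero
constant term. -/
def IsPurelyImproperComm {q k : ℕ} (d : Fin k → MvPowerSeries (Fin q) ℝ) : Prop :=
  ∀ i, MvPowerSeries.constantCoeff (d i) ≠ 0

/-- The Cauchy inverse of a vector of commutative series, componentwise. -/
def cauchyInv {q k : ℕ} (d : Fin k → MvPowerSeries (Fin q) ℝ) :
    Fin k → MvPowerSeries (Fin q) ℝ := fun i => (d i)⁻¹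

/-- The monomial `1∅`. -/
def one (m : ℕ) : Series m := fun η => if η = [] then 1 else 0

/-- The vector `[1 ⋯ 1]ᵗ` of constant series. -/
def ones (m k : ℕ) : VSeries m k := fun _ => one m

/-- Left catenation of a series with the letter `a`, that is `e ↦ a e`. -/
def leftMul {m : ℕ} (a : Fin (m + 1)) (e : Series m) : Series m
  | [] => 0
  | b :: η => if b = a then e η else 0

/-- The shuffle product of two words, as the multiset of the words that occur in it. -/
def shuffleWord {m : ℕ} : Word m → Word m → Multiset (Word m)
  | [], ξ => {ξ}
  | a :: η, [] => {a :: η}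
  | a :: η, b :: ξ =>
      (shuffleWord η (b :: ξ)).map (List.cons a) + (shuffleWord (a :: η) ξ).map (List.cons b)
  termination_by η ξ => η.length + ξ.length

/-- The shuffle product of scalar series, the bilinear extension of the shuffle product of words.
Words of `shuffleWord ζ ν` have length `|ζ| + |ν|`, so each sum has finitely many nonzero terms. -/
def shuffle {m : ℕ} (c d : Series m) : Series m := fun η =>
  ∑ᶠ p : Word m × Word m, c p.1 * d p.2 * ((shuffleWord p.1 p.2).count η : ℝ)

/-- The shuffle product of vector series, componentwise. -/
def vshuffle {m k : ℕ} (c d : VSeries m k) : VSeries m k := fun i => shuffle (c i) (d i)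

/-- The endomorphism attached to a letter:
`x_0 ↦ (e ↦ x_0 e)` and `x_i ↦ (e ↦ x_i (d_i ⧢ e))` for `i = 1, …, m`. -/
def phiLetter {m : ℕ} (d : VSeries m m) (a : Fin (m + 1)) (e : Series m) : Series m :=
  Fin.cases (motive := fun _ => Series m)
    (leftMul 0 e) (fun i => leftMul i.succ (shuffle (d i) e)) a

/-- The endomorphism attached to a word, multiplicative with respect to catenation. -/
def phi {m : ℕ} (d : VSeries m m) : Word m → Series m → Series m
  | [], e => e
  | a :: η, e => phiLetter d a (phi d η e)

/-- The multiplicative mixed composition product `c ∘̃ (δ ⧢ d)`.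
The series `phi d η 1` has no words shorter than `η`, so each coefficient is a finite sum. -/
def mixComp {m k : ℕ} (c : VSeries m k) (d : VSeries m m) : VSeries m k := fun i ν =>
  ∑ᶠ η : Word m, c i η * phi d η (one m) ν

/-- The multiplicative composition product on `δ ⧢ ℝ^m⟨⟨X⟩⟩`, written on representatives:
`(δ ⧢ c) ∘ (δ ⧢ d) = δ ⧢ (d ⧢ (c ∘̃ (δ ⧢ d)))`. -/
def multComp {m : ℕ} (c d : VSeries m m) : VSeries m m := vshuffle d (mixComp c d)

/-- `δ ⧢ g` is a two-sided inverse of `δ ⧢ f` for the multiplicative composition product, whose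
identity element is `δ ⧢ [1 ⋯ 1]ᵗ`. -/
def IsCompInverse {m : ℕ} (f g : VSeries m m) : Prop :=
  multComp f g = ones m m ∧ multComp g f = ones m m

/-- The series `f^{∘ -1}`: the series `g` for which `δ ⧢ g` is the inverse of `δ ⧢ f`
(a meaningless value if there is none). -/
def compInv {m : ℕ} (f : VSeries m m) : VSeries m m :=
  Classical.epsilon fun g => IsCompInverse f g

/-- Shuffle products of components along a word in the letters `x̃_1, …, x̃_q`:
`c^{⧢ ∅} = 1` and `c^{⧢ x̃_i η} = c_i ⧢ c^{⧢ η}`. -/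
def shufflePow {m q : ℕ} (c : VSeries m q) : List (Fin q) → Series m
  | [] => one m
  | i :: η => shuffle (c i) (shufflePow c η)

/-- The commutative monomial with exponents `n`, written as the word `x̃_1 ⋯ x̃_1 x̃_2 ⋯ x̃_q`. -/
def monomialWord {q : ℕ} (n : Fin q →₀ ℕ) : List (Fin q) :=
  (List.finRange q).flatMap fun i => List.replicate (n i) i

/-- The Wiener–Fliess composition product `d ⋄ c = ∑ (d, η) c^{⧢ η}`, over the monomials `η` in
the commuting letters. For proper `c`, the series `c^{⧢ η}` has no words shorter than `η`, so each
coefficient is a finite sum. -/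
def wfComp {m q k : ℕ} (d : Fin k → MvPowerSeries (Fin q) ℝ) (c : VSeries m q) : VSeries m k :=
  fun j ν => ∑ᶠ n : Fin q →₀ ℕ, MvPowerSeries.coeff n (d j) * shufflePow c (monomialWord n) ν

end

end ChenFliess

/-!
The shuffle product makes scalar series a commutative algebra, and for each letter `x_a` the left
shift `D a : c ↦ x_a⁻¹ c` is a derivation of it (`shuffle_cons`). A series is determined by its
constant term and its left shifts, so identities can be proved recursively, one word length at a
time; `EqUpTo n` expresses agreement on words shorter than `n` and is a congruence of the algebra.

The product `c ∘̃ δ_w` keeps the constant term of `c` and satisfies `D 0 (c ∘̃ δ_w) = D 0 c ∘̃ δ_w`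
and `D i (c ∘̃ δ_w) = w_i ⧢ (D i c ∘̃ δ_w)` (`D_mix`). Four facts follow from this recursion.
* `c ↦ c ∘̃ δ_w` is an algebra endomorphism (`mixHom`).
* `∘̃` is a right action of the composition product (`mix_mix`), which is therefore associative.
* `w ↦ c ∘̃ δ_w` is contractive in word length (`mix_congr`), so `g ↦ h ∘̃ δ_g` has exactly one
  fixed point for every `h`.
* If `f ⧢ h = 1`, then `δ_g` is a right inverse of `δ_f` exactly when `g = h ∘̃ δ_g`
  (`comp_eq_one_iff`). Such a `g` is a unit for the shuffle product too, so the inverse is two-sided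
  (`existsUnique_comp_inverse`).

For proper `c`, the series `d ⋄ c` agrees on short words with the value at `c` of a truncation
of `d`. Hence `d ↦ d ⋄ c` is multiplicative (`wf_mul`) and `(d ⋄ c) ∘̃ δ_w = d ⋄ (c ∘̃ δ_w)`
(`mix_wf`). In particular `f = d⁻¹ ⋄ c` has the shuffle inverse `h = d ⋄ c`. Its composition inverse
`g` satisfies `g = h ∘̃ δ_g = d ⋄ (c ∘̃ δ_g)`, so `e = c ∘̃ δ_g` is a fixed point of
`e ↦ c ∘̃ δ_(d ⋄ e)`. Conversely, if `e` is a proper fixed point, then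
`d ⋄ e = d ⋄ (c ∘̃ δ_(d ⋄ e)) = h ∘̃ δ_(d ⋄ e)`, so `d ⋄ e = g` and `e = c ∘̃ δ_g`.
-/

namespace ChenFliess

/-! ### Left shifts and the shuffle product -/

/-- The left shift `x_a⁻¹ c`, whose coefficient of `η` is the coefficient of `x_a η` in `c`. -/
def shift {m : ℕ} (a : Fin (m + 1)) (c : Series m) : Series m := fun η => c (a :: η)

theorem length_of_mem_shuffleWord {m : ℕ} (ζ ξ : Word m) :
    ∀ η ∈ shuffleWord ζ ξ, η.length = ζ.length + ξ.length := by
  induction ζ, ξ using shuffleWord.induct with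
  | case1 ξ => simp [shuffleWord]
  | case2 a ζ => simp [shuffleWord]
  | case3 a ζ b ξ ih₁ ih₂ =>
    intro η hη
    rw [shuffleWord, Multiset.mem_add, Multiset.mem_map, Multiset.mem_map] at hη
    rcases hη with ⟨μ, hμ, rfl⟩ | ⟨μ, hμ, rfl⟩
    · have := ih₁ μ hμ
      simp only [List.length_cons] at this ⊢
      omega
    · have := ih₂ μ hμ
      simp only [List.length_cons] at this ⊢
      omega

theorem count_map_cons {m : ℕ} (a b : Fin (m + 1)) (η : Word m) (s : Multiset (Word m)) :
    (s.map (List.cons a)).count (b :: η) = if a = b then s.count η else 0 := by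
  split_ifs with h
  · subst h
    exact Multiset.count_map_eq_count' _ _ List.cons_injective _
  · rw [Multiset.count_eq_zero, Multiset.mem_map]
    rintro ⟨μ, -, hμ⟩
    exact h (List.cons.inj hμ).1

/-- The contribution to the coefficient of `a η` in `ζ ⧢ ξ` of the shuffles whose first letter
comes from `ζ`. -/
def headCount {m : ℕ} (a : Fin (m + 1)) (η : Word m) : Word m → Word m → ℕ
  | [], _ => 0
  | b :: ζ, ξ => if b = a then (shuffleWord ζ ξ).count η else 0

theorem shuffleWord_nil_right {m : ℕ} (ζ : Word m) : shuffleWord ζ [] = {ζ} := by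
  cases ζ <;> simp [shuffleWord]

theorem count_shuffleWord_comm {m : ℕ} (ζ ξ η : Word m) :
    (shuffleWord ζ ξ).count η = (shuffleWord ξ ζ).count η := by
  congr 1
  induction ζ, ξ using shuffleWord.induct with
  | case1 ξ => rw [shuffleWord_nil_right, shuffleWord]
  | case2 a ζ => rw [shuffleWord_nil_right, shuffleWord]
  | case3 a ζ b ξ ih₁ ih₂ => rw [shuffleWord, shuffleWord, ih₁, ih₂, add_comm]

theorem count_cons_shuffleWord {m : ℕ} (a : Fin (m + 1)) (η ζ ξ : Word m) :
    (shuffleWord ζ ξ).count (a :: η) = headCount a η ζ ξ + headCount a η ξ ζ := by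
  have hsing (b : Fin (m + 1)) (μ : Word m) :
      Multiset.count (a :: η) {b :: μ} = if b = a then Multiset.count η {μ} else 0 := by
    rw [← count_map_cons, Multiset.map_singleton]
  rcases ζ with _ | ⟨b, ζ⟩ <;> rcases ξ with _ | ⟨b', ξ⟩
  · simp [shuffleWord, headCount]
  · rw [shuffleWord, hsing, headCount, headCount, shuffleWord_nil_right, zero_add]
  · rw [shuffleWord, hsing, headCount, headCount, shuffleWord_nil_right, add_zero]
  · rw [shuffleWord, Multiset.count_add, count_map_cons, count_map_cons, headCount, headCount,
      count_shuffleWord_comm ξ]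

theorem shuffle_nil {m : ℕ} (c d : Series m) : shuffle c d [] = c [] * d [] := by
  rw [shuffle, finsum_eq_single _ (([], []) : Word m × Word m)]
  · simp [shuffleWord]
  · rintro ⟨ζ, ξ⟩ h
    rw [Multiset.count_eq_zero_of_notMem, Nat.cast_zero, mul_zero]
    intro hmem
    have := length_of_mem_shuffleWord _ _ _ hmem
    apply h
    simp only [List.length_nil] at this
    rw [List.length_eq_zero_iff.1 (by omega : ζ.length = 0),
      List.length_eq_zero_iff.1 (by omega : ξ.length = 0)]

theorem finsum_eq_finsum_comp {α β : Type*} {f : β → ℝ} {g : α → β} (hg : g.Injective)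
    (hf : ∀ b, b ∉ Set.range g → f b = 0) : ∑ᶠ b, f b = ∑ᶠ a, f (g a) := by
  rw [← finsum_mem_range hg, ← finsum_mem_univ]
  exact finsum_mem_inter_support_eq' _ _ _ fun b hb => by
    simpa using by_contra fun h => hb (hf b h)

/-- The left shift by a letter is a derivation of the shuffle product. With the constant terms, this
recursion determines the product. -/
theorem shuffle_cons {m : ℕ} (c d : Series m) (a : Fin (m + 1)) (η : Word m) :
    shuffle c d (a :: η) = shuffle (shift a c) d η + shuffle c (shift a d) η := by
  have hfin :
      {p : Word m × Word m | p.1.length ≤ η.length + 1 ∧ p.2.length ≤ η.length + 1}.Finite :=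
    (List.finite_length_le _ _).prod (List.finite_length_le _ _)
  have hhead (ζ ξ : Word m) (h : headCount a η ζ ξ ≠ 0) :
      ζ.length ≤ η.length + 1 ∧ ξ.length ≤ η.length + 1 := by
    have h' : (shuffleWord ζ ξ).count (a :: η) ≠ 0 := by
      rw [count_cons_shuffleWord]; omega
    have := length_of_mem_shuffleWord _ _ _ (Multiset.count_ne_zero.1 h')
    simp only [List.length_cons] at this
    omega
  have hsplit : shuffle c d (a :: η) =
      ∑ᶠ p : Word m × Word m, c p.1 * d p.2 * (headCount a η p.1 p.2 : ℝ) +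
      ∑ᶠ p : Word m × Word m, c p.1 * d p.2 * (headCount a η p.2 p.1 : ℝ) := by
    rw [← finsum_add_distrib]
    · refine finsum_congr fun p => ?_
      rw [count_cons_shuffleWord]
      push_cast
      ring
    · refine hfin.subset fun p hp => hhead p.1 p.2 fun h => hp ?_
      simp [h]
    · refine hfin.subset fun p hp => (hhead p.2 p.1 fun h => hp ?_).symm
      simp [h]
  rw [hsplit]
  congr 1
  · rw [finsum_eq_finsum_comp (List.cons_injective.prodMap Function.injective_id :
      (Prod.map (List.cons a) (id : Word m → Word m)).Injective)]
    · refine finsum_congr fun p => ?_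
      simp [headCount, shift]
    · rintro ⟨_ | ⟨b, ζ⟩, ξ⟩ h
      · simp [headCount]
      · rw [headCount, if_neg, Nat.cast_zero, mul_zero]
        rintro rfl
        exact h ⟨(ζ, ξ), rfl⟩
  · rw [finsum_eq_finsum_comp (Function.injective_id.prodMap List.cons_injective :
      (Prod.map (id : Word m → Word m) (List.cons a)).Injective)]
    · refine finsum_congr fun p => ?_
      simp [headCount, shift, count_shuffleWord_comm p.2]
    · rintro ⟨ζ, _ | ⟨b, ξ⟩⟩ h
      · simp [headCount]
      · rw [headCount, if_neg, Nat.cast_zero, mul_zero]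
        rintro rfl
        exact h ⟨(ζ, ξ), rfl⟩

theorem shift_shuffle {m : ℕ} (a : Fin (m + 1)) (c d : Series m) :
    shift a (shuffle c d) = shuffle (shift a c) d + shuffle c (shift a d) :=
  funext fun η => shuffle_cons c d a η

theorem shift_add {m : ℕ} (a : Fin (m + 1)) (c d : Series m) :
    shift a (c + d) = shift a c + shift a d := rfl

theorem shift_smul {m : ℕ} (a : Fin (m + 1)) (r : ℝ) (c : Series m) :
    shift a (r • c) = r • shift a c := rfl

theorem shift_one {m : ℕ} (a : Fin (m + 1)) : shift a (one m) = 0 :=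
  funext fun η => by simp [shift, one]

theorem shuffle_comm {m : ℕ} (c d : Series m) : shuffle c d = shuffle d c := by
  funext η
  induction η generalizing c d with
  | nil => rw [shuffle_nil, shuffle_nil, mul_comm]
  | cons a η ih => rw [shuffle_cons, shuffle_cons, ih, ih c, add_comm]

theorem add_shuffle {m : ℕ} (c c' d : Series m) :
    shuffle (c + c') d = shuffle c d + shuffle c' d := by
  funext η
  induction η generalizing c c' d with
  | nil => simp only [Pi.add_apply, shuffle_nil, add_mul]
  | cons a η ih =>
    simp only [Pi.add_apply, shuffle_cons, shift_add, ih]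
    ring

theorem smul_shuffle {m : ℕ} (r : ℝ) (c d : Series m) :
    shuffle (r • c) d = r • shuffle c d := by
  funext η
  induction η generalizing c d with
  | nil => simp only [Pi.smul_apply, shuffle_nil, smul_eq_mul, mul_assoc]
  | cons a η ih =>
    simp only [Pi.smul_apply, shuffle_cons, shift_smul, ih, smul_add]

theorem zero_shuffle {m : ℕ} (d : Series m) : shuffle 0 d = 0 := by
  simpa using smul_shuffle 0 0 d

theorem one_shuffle {m : ℕ} (d : Series m) : shuffle (one m) d = d := by
  funext η
  induction η generalizing d with
  | nil => simp [shuffle_nil, one]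
  | cons a η ih => rw [shuffle_cons, shift_one, zero_shuffle, ih]; simp [shift]

theorem shuffle_assoc {m : ℕ} (c d e : Series m) :
    shuffle (shuffle c d) e = shuffle c (shuffle d e) := by
  have shuffle_add (c d d' : Series m) : shuffle c (d + d') = shuffle c d + shuffle c d' := by
    rw [shuffle_comm, add_shuffle, shuffle_comm d, shuffle_comm d']
  funext η
  induction η generalizing c d e with
  | nil => simp only [shuffle_nil, mul_assoc]
  | cons a η ih =>
    simp only [shuffle_cons, shift_shuffle, add_shuffle, shuffle_add, Pi.add_apply, ih]
    ring

/-- Scalar series with the shuffle product as multiplication. A separate name keeps this ring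
structure apart from the pointwise one on functions. -/
def ShuffleAlg (m : ℕ) : Type := Series m

namespace ShuffleAlg

noncomputable instance (m : ℕ) : AddCommGroup (ShuffleAlg m) :=
  inferInstanceAs (AddCommGroup (Word m → ℝ))

noncomputable instance (m : ℕ) : Module ℝ (ShuffleAlg m) :=
  inferInstanceAs (Module ℝ (Word m → ℝ))

noncomputable instance (m : ℕ) : CommRing (ShuffleAlg m) where
  mul := shuffle
  one := one m
  zero_mul := zero_shuffle
  mul_zero c := (shuffle_comm c 0).trans (zero_shuffle c)
  mul_assoc := shuffle_assoc
  mul_comm := shuffle_comm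
  one_mul := one_shuffle
  mul_one c := (shuffle_comm c (one m)).trans (one_shuffle c)
  right_distrib := add_shuffle
  left_distrib c d d' :=
    (shuffle_comm c (d + d')).trans <| (add_shuffle d d' c).trans <|
      congrArg₂ (· + ·) (shuffle_comm d c) (shuffle_comm d' c)
  neg_add_cancel := neg_add_cancel
  zsmul := (· • ·)
  zsmul_zero' := SubNegMonoid.zsmul_zero'
  zsmul_succ' := SubNegMonoid.zsmul_succ'
  zsmul_neg' := SubNegMonoid.zsmul_neg'
  nsmul := (· • ·)
  nsmul_zero := AddMonoid.nsmul_zero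
  nsmul_succ := AddMonoid.nsmul_succ
  sub_eq_add_neg := sub_eq_add_neg

noncomputable instance (m : ℕ) : Algebra ℝ (ShuffleAlg m) :=
  Algebra.ofModule smul_shuffle fun r c d =>
    (shuffle_comm c (r • d)).trans <| (smul_shuffle r d c).trans <|
      congrArg (r • ·) (shuffle_comm d c)

variable {m : ℕ}

/-- The coefficient of a word, as a linear form on the shuffle algebra. -/
def coeff (η : Word m) : ShuffleAlg m →ₗ[ℝ] ℝ where
  toFun c := c η
  map_add' _ _ := rfl
  map_smul' _ _ := rfl

/-- The left shift by a letter, as a linear map on the shuffle algebra. -/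
def D (a : Fin (m + 1)) : ShuffleAlg m →ₗ[ℝ] ShuffleAlg m where
  toFun c := shift a c
  map_add' _ _ := rfl
  map_smul' _ _ := rfl

theorem D_mul (a : Fin (m + 1)) (c d : ShuffleAlg m) : D a (c * d) = D a c * d + c * D a d :=
  shift_shuffle a c d

theorem coeff_nil_mul (c d : ShuffleAlg m) : coeff [] (c * d) = coeff [] c * coeff [] d :=
  shuffle_nil c d

theorem coeff_nil_one : coeff [] (1 : ShuffleAlg m) = 1 :=
  show one m [] = 1 from if_pos rfl

theorem coeff_cons (a : Fin (m + 1)) (η : Word m) (c : ShuffleAlg m) :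
    coeff (a :: η) c = coeff η (D a c) := rfl

@[ext] theorem ext {c d : ShuffleAlg m} (h : ∀ η, coeff η c = coeff η d) : c = d := funext h

/-! ### Series that agree on short words -/

/-- `c` and `d` have the same coefficients on all words of length less than `n`. -/
def EqUpTo (n : ℕ) (c d : ShuffleAlg m) : Prop := ∀ η : Word m, η.length < n → coeff η c = coeff η d

theorem EqUpTo.refl (n : ℕ) (c : ShuffleAlg m) : EqUpTo n c c := fun _ _ => rfl

theorem EqUpTo.symm {n : ℕ} {c d : ShuffleAlg m} (h : EqUpTo n c d) : EqUpTo n d c :=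
  fun η hη => (h η hη).symm

theorem EqUpTo.trans {n : ℕ} {c d e : ShuffleAlg m} (h : EqUpTo n c d) (h' : EqUpTo n d e) :
    EqUpTo n c e := fun η hη => (h η hη).trans (h' η hη)

theorem EqUpTo.mono {n k : ℕ} (hk : k ≤ n) {c d : ShuffleAlg m} (h : EqUpTo n c d) :
    EqUpTo k c d := fun η hη => h η (hη.trans_le hk)

theorem EqUpTo.zero (c d : ShuffleAlg m) : EqUpTo 0 c d := fun _ h => absurd h (Nat.not_lt_zero _)

theorem EqUpTo.succ {n : ℕ} {c d : ShuffleAlg m} (h₀ : coeff [] c = coeff [] d)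
    (h : ∀ a, EqUpTo n (D a c) (D a d)) : EqUpTo (n + 1) c d
  | [], _ => h₀
  | a :: η, hη => h a η (Nat.lt_of_succ_lt_succ hη)

theorem EqUpTo.D {n : ℕ} {c d : ShuffleAlg m} (h : EqUpTo (n + 1) c d) (a : Fin (m + 1)) :
    EqUpTo n (D a c) (D a d) := fun η hη => h (a :: η) (Nat.succ_lt_succ hη)

theorem eq_of_forall_eqUpTo {c d : ShuffleAlg m} (h : ∀ n, EqUpTo n c d) : c = d :=
  ext fun η => h (η.length + 1) η (Nat.lt_succ_self _)

theorem EqUpTo.add {n : ℕ} {c c' d d' : ShuffleAlg m} (h : EqUpTo n c c') (h' : EqUpTo n d d') :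
    EqUpTo n (c + d) (c' + d') := fun η hη => by
  rw [map_add, map_add, h η hη, h' η hη]

theorem EqUpTo.mul {n : ℕ} {c c' d d' : ShuffleAlg m} (h : EqUpTo n c c') (h' : EqUpTo n d d') :
    EqUpTo n (c * d) (c' * d') := by
  induction n generalizing c c' d d' with
  | zero => exact .zero _ _
  | succ n ih =>
    refine .succ ?_ fun a => ?_
    · rw [coeff_nil_mul, coeff_nil_mul, h [] n.succ_pos, h' [] n.succ_pos]
    · rw [D_mul, D_mul]
      exact (ih (h.D a) (h'.mono n.le_succ)).add (ih (h.mono n.le_succ) (h'.D a))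

/-- The product of two series without words shorter than `k`, respectively `l`, has no words shorter
than `k + l`. -/
theorem EqUpTo.mul_vanish {k l : ℕ} {c d : ShuffleAlg m} (hc : EqUpTo k c 0) (hd : EqUpTo l d 0) :
    EqUpTo (k + l) (c * d) 0 := by
  intro η
  induction η generalizing k l c d with
  | nil =>
    intro h
    rw [coeff_nil_mul, map_zero]
    rcases Nat.eq_zero_or_pos k with rfl | hk
    · rw [hd [] (by simpa using h), map_zero, mul_zero]
    · rw [hc [] hk, map_zero, zero_mul]
  | cons a η ih =>
    intro h
    have shift {n : ℕ} {e : ShuffleAlg m} (he : EqUpTo n e 0) :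
        EqUpTo (n - 1) (ShuffleAlg.D a e) 0 := fun μ hμ =>
      he (a :: μ) (by rw [List.length_cons]; omega)
    rw [List.length_cons] at h
    rw [coeff_cons, D_mul, map_add, ih (shift hc) hd (by omega), ih hc (shift hd) (by omega)]
    simp

noncomputable section

/-! ### The mixed composition product -/

/-- The series that multiplies the argument in the endomorphism of a letter: `1` for `x_0` and `w_i`
for `x_i`. -/
def letterFactor (w : Fin m → ShuffleAlg m) : Fin (m + 1) → ShuffleAlg m := Fin.cons 1 w

theorem phiLetter_cons (w : Fin m → ShuffleAlg m) (a b : Fin (m + 1)) (e : ShuffleAlg m)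
    (ν : Word m) :
    phiLetter w a e (b :: ν) = if b = a then coeff ν (letterFactor w a * e) else 0 := by
  cases a using Fin.cases with
  | zero =>
    have h : letterFactor w 0 * e = e := one_mul e
    rw [h]
    rfl
  | succ i => rfl

theorem phiLetter_nil (w : Fin m → ShuffleAlg m) (a : Fin (m + 1)) (e : ShuffleAlg m) :
    phiLetter w a e [] = 0 := by
  cases a using Fin.cases <;> rfl

/-- The series `φ̄_w(η)(1)`. -/
def phiOne (w : Fin m → ShuffleAlg m) (η : Word m) : ShuffleAlg m := phi w η (one m)

theorem phiOne_cons_apply (w : Fin m → ShuffleAlg m) (a b : Fin (m + 1)) (η ν : Word m) :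
    coeff (b :: ν) (phiOne w (a :: η)) =
      if b = a then coeff ν (letterFactor w a * phiOne w η) else 0 :=
  phiLetter_cons w a b (phiOne w η) ν

/-- `φ̄_w(η)(1)` has no words shorter than `η`. -/
theorem phiOne_eqUpTo_zero (w : Fin m → ShuffleAlg m) (η : Word m) :
    EqUpTo η.length (phiOne w η) 0 := by
  induction η with
  | nil => exact .zero _ _
  | cons a η ih =>
    refine .succ (phiLetter_nil w a _) fun b ν hν => ?_
    refine (phiOne_cons_apply w a b η ν).trans ?_
    split_ifs
    · have h := (EqUpTo.refl η.length (letterFactor w a)).mul ih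
      rw [mul_zero] at h
      exact h ν hν
    · rfl

/-- The mixed composition product `c ∘̃ δ_w` of a scalar series `c`. -/
def mix (w : Fin m → ShuffleAlg m) (c : ShuffleAlg m) : ShuffleAlg m := fun ν =>
  ∑ᶠ η : Word m, c η * phi w η (one m) ν

theorem coeff_nil_mix (w : Fin m → ShuffleAlg m) (c : ShuffleAlg m) :
    coeff [] (mix w c) = coeff [] c := by
  refine (finsum_eq_single _ [] fun η hη => ?_).trans ?_
  · have h := phiOne_eqUpTo_zero w η [] (List.length_pos_iff.2 hη)
    exact mul_eq_zero_of_right _ h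
  · exact (congrArg (c [] * ·) (coeff_nil_one (m := m))).trans (mul_one _)

/-- On short words the mixed composition product is a finite linear combination. -/
theorem mix_eqUpTo (w : Fin m → ShuffleAlg m) (c : ShuffleAlg m) (n : ℕ) :
    EqUpTo n (mix w c) (∑ η ∈ (List.finite_length_le (Fin (m + 1)) n).toFinset,
      coeff η c • (phiOne w η)) := by
  intro ν hν
  rw [map_sum]
  refine finsum_eq_sum_of_support_subset _ fun η hη => ?_
  rw [Set.Finite.coe_toFinset]
  by_contra h
  exact hη (mul_eq_zero_of_right _ (phiOne_eqUpTo_zero w η ν (hν.trans (not_le.1 h))))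

/-- With the constant term, this recursion determines the mixed composition product. -/
theorem D_mix (w : Fin m → ShuffleAlg m) (c : ShuffleAlg m) (a : Fin (m + 1)) :
    D a (mix w c) = letterFactor w a * mix w (D a c) := by
  ext ν
  have hcons : coeff ν (D a (mix w c)) =
      ∑ᶠ η : Word m, coeff η (D a c) * coeff ν (letterFactor w a * phiOne w η) := by
    refine (finsum_eq_finsum_comp (List.cons_injective (a := a)) ?_).trans
      (finsum_congr fun η => ?_)
    · rintro (_ | ⟨b, η⟩) h
      · exact mul_eq_zero_of_right _ (show one m (a :: ν) = 0 from if_neg (List.cons_ne_nil _ _))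
      · refine mul_eq_zero_of_right _ ((phiOne_cons_apply w b a η ν).trans (if_neg ?_))
        rintro rfl
        exact h ⟨η, rfl⟩
    · exact congrArg (c (a :: η) * ·) ((phiOne_cons_apply w a a η ν).trans (if_pos rfl))
  rw [hcons, ((EqUpTo.refl _ _).mul (mix_eqUpTo w (D a c) (ν.length + 1))) ν (Nat.lt_succ_self _),
    Finset.mul_sum, map_sum]
  refine (finsum_eq_sum_of_support_subset _ fun η hη => ?_).trans
    (Finset.sum_congr rfl fun η _ => ?_)
  · rw [Set.Finite.coe_toFinset]
    by_contra h
    have h0 := (EqUpTo.refl _ (letterFactor w a)).mul (phiOne_eqUpTo_zero w η)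
    rw [mul_zero] at h0
    exact hη (mul_eq_zero_of_right _ (h0 ν ((Nat.lt_succ_self _).trans (not_le.1 h))))
  · rw [mul_smul_comm, map_smul, smul_eq_mul]

/-- A family of maps that satisfies the recursion of `c ↦ c ∘̃ δ_w` is that map. -/
theorem eq_mix_of_recursion {w : Fin m → ShuffleAlg m} {F : ShuffleAlg m → ShuffleAlg m}
    (h₀ : ∀ c, coeff [] (F c) = coeff [] c)
    (hD : ∀ a c, D a (F c) = letterFactor w a * F (D a c)) (c : ShuffleAlg m) : F c = mix w c := by
  refine eq_of_forall_eqUpTo fun n => ?_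
  induction n generalizing c with
  | zero => exact .zero _ _
  | succ n ih =>
    refine .succ (by rw [h₀, coeff_nil_mix]) fun a => ?_
    rw [hD, D_mix]
    exact (EqUpTo.refl _ _).mul (ih _)

theorem mix_add (w : Fin m → ShuffleAlg m) (c d : ShuffleAlg m) :
    mix w (c + d) = mix w c + mix w d := by
  refine eq_of_forall_eqUpTo fun n => ?_
  induction n generalizing c d with
  | zero => exact .zero _ _
  | succ n ih =>
    refine .succ (by simp only [coeff_nil_mix, map_add]) fun a => ?_
    rw [map_add, D_mix, D_mix, D_mix, ← mul_add, map_add]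
    exact (EqUpTo.refl _ _).mul (ih _ _)

theorem mix_smul (w : Fin m → ShuffleAlg m) (r : ℝ) (c : ShuffleAlg m) :
    mix w (r • c) = r • mix w c := by
  refine eq_of_forall_eqUpTo fun n => ?_
  induction n generalizing c with
  | zero => exact .zero _ _
  | succ n ih =>
    refine .succ (by simp only [coeff_nil_mix, map_smul]) fun a => ?_
    rw [map_smul, D_mix, D_mix, ← mul_smul_comm, map_smul]
    exact (EqUpTo.refl _ _).mul (ih _)

/-- Composition distributes over the shuffle product, because both sides satisfy the Leibniz
recursion. -/
theorem mix_mul (w : Fin m → ShuffleAlg m) (c d : ShuffleAlg m) :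
    mix w (c * d) = mix w c * mix w d := by
  refine eq_of_forall_eqUpTo fun n => ?_
  induction n generalizing c d with
  | zero => exact .zero _ _
  | succ n ih =>
    refine .succ (by simp only [coeff_nil_mix, coeff_nil_mul]) fun a => ?_
    have h : D a (mix w c * mix w d) =
        letterFactor w a * (mix w (D a c) * mix w d + mix w c * mix w (D a d)) := by
      rw [D_mul, D_mix, D_mix]
      ring
    rw [D_mix, D_mul, mix_add, h]
    exact (EqUpTo.refl _ _).mul ((ih _ _).add (ih _ _))

theorem D_one (a : Fin (m + 1)) : D a (1 : ShuffleAlg m) = 0 := shift_one a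

theorem mix_one (w : Fin m → ShuffleAlg m) : mix w 1 = 1 := by
  refine eq_of_forall_eqUpTo fun n => ?_
  cases n with
  | zero => exact .zero _ _
  | succ n =>
    refine .succ (coeff_nil_mix w 1) fun a => ?_
    have h0 : mix w 0 = 0 := by simpa using mix_smul w 0 0
    rw [D_mix, D_one, h0, mul_zero]
    exact .refl _ _

/-- For fixed `w`, the map `c ↦ c ∘̃ δ_w` is an endomorphism of the shuffle algebra. -/
def mixHom (w : Fin m → ShuffleAlg m) : ShuffleAlg m →ₐ[ℝ] ShuffleAlg m :=
  AlgHom.ofLinearMap ⟨⟨mix w, mix_add w⟩, mix_smul w⟩ (mix_one w) (mix_mul w)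

theorem mixHom_apply (w : Fin m → ShuffleAlg m) (c : ShuffleAlg m) : mixHom w c = mix w c := rfl

/-- The mixed composition product is a right action of the composition product. -/
theorem mix_mix (f g : Fin m → ShuffleAlg m) (c : ShuffleAlg m) :
    mix g (mix f c) = mix (fun i => g i * mix g (f i)) c := by
  refine eq_mix_of_recursion (F := fun c => mix g (mix f c)) (fun c => ?_) (fun a c => ?_) c
  · rw [coeff_nil_mix, coeff_nil_mix]
  · rw [D_mix, D_mix, mix_mul, ← mul_assoc]
    congr 1
    cases a using Fin.cases with
    | zero => exact (congrArg (1 * ·) (mix_one g)).trans (one_mul 1)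
    | succ i => rfl

theorem mix_ones (c : ShuffleAlg m) : mix (fun _ => 1) c = c := by
  refine (eq_mix_of_recursion (F := id) (fun _ => rfl) (fun a c => ?_) c).symm
  have h : letterFactor (fun _ : Fin m => (1 : ShuffleAlg m)) a = 1 := by
    cases a using Fin.cases <;> rfl
  rw [h, one_mul, id, id]

theorem mix_congr_right {n : ℕ} (w : Fin m → ShuffleAlg m) {c d : ShuffleAlg m} (h : EqUpTo n c d) :
    EqUpTo n (mix w c) (mix w d) := by
  induction n generalizing c d with
  | zero => exact .zero _ _
  | succ n ih =>
    refine .succ (by rw [coeff_nil_mix, coeff_nil_mix, h [] n.succ_pos]) fun a => ?_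
    rw [D_mix, D_mix]
    exact (EqUpTo.refl _ _).mul (ih (h.D a))

/-- In its second argument the mixed composition product is contractive: `w_i` is always preceded by
a letter, so the coefficients on words of length `n` involve `w` on shorter words only. -/
theorem mix_congr {n : ℕ} {w w' : Fin m → ShuffleAlg m} (h : ∀ i, EqUpTo n (w i) (w' i))
    (c : ShuffleAlg m) : EqUpTo (n + 1) (mix w c) (mix w' c) := by
  induction n generalizing c with
  | zero =>
    exact .succ (by rw [coeff_nil_mix, coeff_nil_mix]) fun a => .zero _ _
  | succ n ih =>
    refine .succ (by rw [coeff_nil_mix, coeff_nil_mix]) fun a => ?_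
    rw [D_mix, D_mix]
    refine EqUpTo.mul ?_ (ih (fun i => (h i).mono n.le_succ) _)
    cases a using Fin.cases with
    | zero => exact .refl _ _
    | succ i => exact h i

/-! ### The composition group -/

/-- A contractive map on families of series has exactly one fixed point. -/
theorem existsUnique_fixedPoint {ι : Type*} {T : (ι → ShuffleAlg m) → ι → ShuffleAlg m}
    (hT : ∀ n w w', (∀ i, EqUpTo n (w i) (w' i)) → ∀ i, EqUpTo (n + 1) (T w i) (T w' i)) :
    ∃! w, T w = w := by
  have hstep (n : ℕ) : ∀ i, EqUpTo n (T^[n] 0 i) (T^[n + 1] 0 i) := by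
    induction n with
    | zero => exact fun i => .zero _ _
    | succ n ih =>
      rw [Function.iterate_succ_apply', Function.iterate_succ_apply' T (n + 1)]
      exact hT n _ _ ih
  have hle {n k : ℕ} (hk : n ≤ k) (i : ι) : EqUpTo n (T^[n] 0 i) (T^[k] 0 i) := by
    induction k, hk using Nat.le_induction with
    | base => exact .refl _ _
    | succ k hk ih => exact ih.trans ((hstep k i).mono hk)
  -- The coefficients on words of length `n` are stationary after `n + 1` iterations.
  let w : ι → ShuffleAlg m := fun i η => coeff η (T^[η.length + 1] 0 i)
  have hw (n : ℕ) (i : ι) : EqUpTo n (w i) (T^[n] 0 i) := fun η hη =>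
    hle hη i η (Nat.lt_succ_self _)
  have hTw : T w = w := funext fun i => eq_of_forall_eqUpTo fun n => by
    have h := hT n _ _ (hw n) i
    rw [← Function.iterate_succ_apply' T] at h
    exact (h.trans (hw (n + 1) i).symm).mono n.le_succ
  refine ⟨w, hTw, fun v hv => funext fun i => eq_of_forall_eqUpTo fun n => ?_⟩
  induction n generalizing i with
  | zero => exact .zero _ _
  | succ n ih =>
    have h := hT n v w ih i
    rwa [hv, hTw] at h

/-- The composition product of `δ_f` and `δ_g`, on representatives. -/
def comp (f g : Fin m → ShuffleAlg m) : Fin m → ShuffleAlg m := fun i => g i * mix g (f i)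

theorem comp_assoc (f g h : Fin m → ShuffleAlg m) : comp (comp f g) h = comp f (comp g h) := by
  funext i
  simp only [comp, mix_mul]
  rw [mix_mix, mul_assoc]
  rfl

theorem comp_ones (f : Fin m → ShuffleAlg m) : comp f (fun _ => 1) = f :=
  funext fun i => by rw [comp, mix_ones, one_mul]

theorem ones_comp (f : Fin m → ShuffleAlg m) : comp (fun _ => 1) f = f :=
  funext fun i => by rw [comp, mix_one, mul_one]

/-- If `f` has the shuffle inverse `h`, the right inverses of `δ_f` are the fixed points of
`g ↦ h ∘̃ δ_g`. -/
theorem comp_eq_one_iff {f h : Fin m → ShuffleAlg m} (hfh : ∀ i, f i * h i = 1)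
    (g : Fin m → ShuffleAlg m) : (comp f g = fun _ => 1) ↔ (fun i => mix g (h i)) = g := by
  have hmix (i : Fin m) : mix g (f i) * mix g (h i) = 1 := by rw [← mix_mul, hfh, mix_one]
  constructor
  · intro hg
    funext i
    have hi : g i * mix g (f i) = 1 := congrFun hg i
    calc mix g (h i) = g i * mix g (f i) * mix g (h i) := by rw [hi, one_mul]
      _ = g i := by rw [mul_assoc, hmix, mul_one]
  · intro hg
    funext i
    have hi : mix g (h i) = g i := congrFun hg i
    rw [comp, ← hi, mul_comm, hmix]

/-- The map `g ↦ h ∘̃ δ_g` is contractive, hence has exactly one fixed point. -/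
theorem existsUnique_mix_fixedPoint (h : Fin m → ShuffleAlg m) :
    ∃! g : Fin m → ShuffleAlg m, (fun i => mix g (h i)) = g :=
  existsUnique_fixedPoint (T := fun g i => mix g (h i)) fun _ _ _ hw i => mix_congr hw (h i)

/-- If every component of `f` is a unit of the shuffle algebra, then `δ_f` is invertible. -/
theorem existsUnique_comp_inverse {f h : Fin m → ShuffleAlg m} (hfh : ∀ i, f i * h i = 1) :
    ∃! g : Fin m → ShuffleAlg m, (comp f g = fun _ => 1) ∧ comp g f = fun _ => 1 := by
  obtain ⟨g, hg, huniq⟩ := existsUnique_mix_fixedPoint h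
  have hfg := (comp_eq_one_iff hfh g).2 hg
  -- The right inverse `g` has the shuffle inverse `f ∘̃ δ_g`, so it has a right inverse itself.
  obtain ⟨g', hg', -⟩ := existsUnique_mix_fixedPoint fun i => mix g (f i)
  have hgg' : comp g g' = fun _ => 1 :=
    (comp_eq_one_iff (fun i => congrFun hfg i) g').2 hg'
  have hf : f = g' := by rw [← comp_ones f, ← hgg', ← comp_assoc, hfg, ones_comp]
  exact ⟨g, ⟨hfg, hf ▸ hgg'⟩, fun k hk => huniq k ((comp_eq_one_iff hfh k).1 hk.1)⟩

variable {q : ℕ}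

/-! ### The Wiener–Fliess composition product -/

theorem shufflePow_eq_prod (c : Fin q → ShuffleAlg m) (l : List (Fin q)) :
    (shufflePow c l : ShuffleAlg m) = (l.map c).prod := by
  induction l with
  | nil => rfl
  | cons i l ih => exact congrArg (c i * ·) ih

/-- The shuffle power of `c` with exponents `n`. -/
def monomialPow (c : Fin q → ShuffleAlg m) (n : Fin q →₀ ℕ) : ShuffleAlg m :=
  shufflePow c (monomialWord n)

theorem monomialPow_eq_prod (c : Fin q → ShuffleAlg m) (n : Fin q →₀ ℕ) :
    monomialPow c n = ∏ i, c i ^ n i := by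
  have h (L : List (Fin q)) : ((L.flatMap fun i => List.replicate (n i) i).map c).prod =
      (L.map fun i => c i ^ n i).prod := by
    induction L with
    | nil => rfl
    | cons i L ih => simp [List.flatMap_cons, ih]
  rw [Fin.prod_univ_def, ← h]
  exact shufflePow_eq_prod c _

theorem length_monomialWord (n : Fin q →₀ ℕ) : (monomialWord n).length = n.degree := by
  rw [Finsupp.degree_eq_sum, Fin.sum_univ_def, monomialWord, List.length_flatMap]
  simp

/-- For proper `c`, the powers of `c` of degree `k` have no words shorter than `k`. -/
theorem monomialPow_eqUpTo_zero {c : Fin q → ShuffleAlg m} (hc : ∀ i, coeff [] (c i) = 0)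
    (n : Fin q →₀ ℕ) : EqUpTo n.degree (monomialPow c n) 0 := by
  have h (l : List (Fin q)) : EqUpTo l.length (l.map c).prod 0 := by
    induction l with
    | nil => exact .zero _ _
    | cons i l ih =>
      have hi : EqUpTo 1 (c i) 0 := .succ (by rw [hc, map_zero]) fun a => .zero _ _
      rw [List.map_cons, List.prod_cons, List.length_cons, add_comm]
      exact hi.mul_vanish ih
  rw [← length_monomialWord]
  have h' := h (monomialWord n)
  rwa [← shufflePow_eq_prod] at h'

/-- The Wiener–Fliess composition product `d ⋄ c` of a scalar series `d`. -/
def wf (d : MvPowerSeries (Fin q) ℝ) (c : Fin q → ShuffleAlg m) : ShuffleAlg m := fun ν =>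
  ∑ᶠ n : Fin q →₀ ℕ, MvPowerSeries.coeff n d * shufflePow c (monomialWord n) ν

theorem coeff_aeval (c : Fin q → ShuffleAlg m) (p : MvPolynomial (Fin q) ℝ) (ν : Word m) :
    coeff ν (MvPolynomial.aeval c p) =
      ∑ᶠ n : Fin q →₀ ℕ, p.coeff n * coeff ν (monomialPow c n) := by
  rw [MvPolynomial.aeval_def, MvPolynomial.eval₂_eq', map_sum]
  refine (Finset.sum_congr rfl fun n _ => ?_).trans
    (finsum_eq_sum_of_support_subset (s := p.support) _ fun n hn => ?_).symm
  · rw [← Algebra.smul_def, map_smul, smul_eq_mul, monomialPow_eq_prod]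
  · rw [Finset.mem_coe, MvPolynomial.mem_support_iff]
    exact left_ne_zero_of_mul hn

/-- On words of length less than `N`, the series `d ⋄ c` is the value at `c` of any polynomial that
agrees with `d` in degrees less than `N`. This transfers identities from polynomials to `⋄`. -/
theorem wf_eqUpTo {c : Fin q → ShuffleAlg m} (hc : ∀ i, coeff [] (c i) = 0) {N : ℕ}
    {d : MvPowerSeries (Fin q) ℝ} {p : MvPolynomial (Fin q) ℝ}
    (h : ∀ n : Fin q →₀ ℕ, n.degree < N → p.coeff n = MvPowerSeries.coeff n d) :
    EqUpTo N (wf d c) (MvPolynomial.aeval c p) := by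
  intro ν hν
  rw [coeff_aeval]
  refine finsum_congr fun n => ?_
  by_cases hn : n.degree < N
  · rw [h n hn]
    rfl
  · have h0 : coeff ν (monomialPow c n) = 0 :=
      monomialPow_eqUpTo_zero hc n ν (hν.trans_le (not_lt.1 hn))
    rw [h0, mul_zero]
    exact mul_eq_zero_of_right _ h0

theorem wf_eqUpTo_truncTotal {c : Fin q → ShuffleAlg m} (hc : ∀ i, coeff [] (c i) = 0) (N : ℕ)
    (d : MvPowerSeries (Fin q) ℝ) :
    EqUpTo N (wf d c) (MvPolynomial.aeval c (d.truncTotal N)) :=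
  wf_eqUpTo hc fun _ hn => MvPowerSeries.coeff_truncTotal d hn

theorem wf_mul {c : Fin q → ShuffleAlg m} (hc : ∀ i, coeff [] (c i) = 0)
    (d e : MvPowerSeries (Fin q) ℝ) : wf (d * e) c = wf d c * wf e c := by
  refine eq_of_forall_eqUpTo fun N => ?_
  refine (wf_eqUpTo (p := d.truncTotal N * e.truncTotal N) hc fun n hn =>
    MvPowerSeries.coeff_truncTotal_mul_truncTotal_eq_coeff_mul _ _ hn).trans ?_
  rw [map_mul]
  exact ((wf_eqUpTo_truncTotal hc N d).mul (wf_eqUpTo_truncTotal hc N e)).symm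

theorem wf_one {c : Fin q → ShuffleAlg m} (hc : ∀ i, coeff [] (c i) = 0) : wf 1 c = 1 := by
  refine eq_of_forall_eqUpTo fun N => ?_
  have h := wf_eqUpTo (N := N) (d := 1) (p := 1) hc fun n _ => by
    rw [← MvPolynomial.coeff_coe, MvPolynomial.coe_one]
  rwa [map_one] at h

theorem coeff_nil_wf {c : Fin q → ShuffleAlg m} (hc : ∀ i, coeff [] (c i) = 0)
    (d : MvPowerSeries (Fin q) ℝ) : coeff [] (wf d c) = MvPowerSeries.constantCoeff d := by
  have h := wf_eqUpTo (N := 1) (d := d) (p := MvPolynomial.C (MvPowerSeries.constantCoeff d)) hc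
    fun n hn => by
      rw [(Finsupp.degree_eq_zero_iff n).1 (Nat.lt_one_iff.1 hn), MvPolynomial.coeff_zero_C,
        MvPowerSeries.coeff_zero_eq_constantCoeff_apply]
  rw [h [] Nat.one_pos, MvPolynomial.aeval_C, Algebra.algebraMap_eq_smul_one, map_smul,
    coeff_nil_one, smul_eq_mul, mul_one]

/-- The mixed composition product passes through the Wiener–Fliess product:
`(d ⋄ c) ∘̃ δ_w = d ⋄ (c ∘̃ δ_w)`. -/
theorem mix_wf {c : Fin q → ShuffleAlg m} (hc : ∀ i, coeff [] (c i) = 0)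
    (d : MvPowerSeries (Fin q) ℝ) (w : Fin m → ShuffleAlg m) :
    mix w (wf d c) = wf d fun i => mix w (c i) := by
  refine eq_of_forall_eqUpTo fun N => ?_
  have hc' (i : Fin q) : coeff [] (mix w (c i)) = 0 := by rw [coeff_nil_mix, hc]
  refine (mix_congr_right w (wf_eqUpTo_truncTotal hc N d)).trans ?_
  rw [← mixHom_apply, MvPolynomial.comp_aeval_apply]
  exact (wf_eqUpTo_truncTotal hc' N d).symm

end

end ShuffleAlg

/-! ### The feedback fixed point -/

theorem IsCompInverse.compInv_eq {m : ℕ} {f g : VSeries m m} (hg : IsCompInverse f g)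
    (huniq : ∀ k, IsCompInverse f k → k = g) : compInv f = g :=
  huniq _ (Classical.epsilon_spec (p := fun k => IsCompInverse f k) ⟨g, hg⟩)

end ChenFliess

theorem mainTheorem5 (m q : ℕ)
    (c : ChenFliess.VSeries m q) (hc : ChenFliess.IsProper c)
    (d : Fin m → MvPowerSeries (Fin q) ℝ) (hd : ChenFliess.IsPurelyImproperComm d) :
    -- the inverse `(d⁻¹ ⋄ c)^{∘ -1}` is well defined
    ChenFliess.IsPurelyImproper (ChenFliess.wfComp (ChenFliess.cauchyInv d) c) ∧
    (∃! g, ChenFliess.IsCompInverse (ChenFliess.wfComp (ChenFliess.cauchyInv d) c) g) ∧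
    -- the series `c ∘̃ (δ ⧢ (d⁻¹ ⋄ c)^{∘ -1})` is proper
    ChenFliess.IsProper
      (ChenFliess.mixComp c
        (ChenFliess.compInv (ChenFliess.wfComp (ChenFliess.cauchyInv d) c))) ∧
    -- it is a fixed point of `e ↦ c ∘̃ (δ ⧢ (d ⋄ e))`
    Function.IsFixedPt (fun e => ChenFliess.mixComp c (ChenFliess.wfComp d e))
      (ChenFliess.mixComp c
        (ChenFliess.compInv (ChenFliess.wfComp (ChenFliess.cauchyInv d) c))) ∧
    -- and the only one among the proper series
    ∀ e : ChenFliess.VSeries m q, ChenFliess.IsProper e →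
      Function.IsFixedPt (fun e' => ChenFliess.mixComp c (ChenFliess.wfComp d e')) e →
      e = ChenFliess.mixComp c
        (ChenFliess.compInv (ChenFliess.wfComp (ChenFliess.cauchyInv d) c)) := by
  open ChenFliess ShuffleAlg in
  let f : Fin m → ShuffleAlg m := fun i => wf (d i)⁻¹ c
  let h : Fin m → ShuffleAlg m := fun i => wf (d i) c
  have hfh (i : Fin m) : f i * h i = 1 := by
    have hi := wf_mul hc (d i)⁻¹ (d i)
    rw [MvPowerSeries.inv_mul_cancel _ (hd i), wf_one hc] at hi
    exact hi.symm
  obtain ⟨g, hg, huniq⟩ := existsUnique_comp_inverse hfh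
  have hinv : compInv (wfComp (cauchyInv d) c) = g := IsCompInverse.compInv_eq hg huniq
  have hfix : (fun i => mix g (h i)) = g := (comp_eq_one_iff hfh g).1 hg.1
  have hproper : IsProper (mixComp c g) := fun i => (coeff_nil_mix g (c i)).trans (hc i)
  have hwf (w : Fin m → ShuffleAlg m) : wfComp d (mixComp c w) = fun i => mix w (h i) :=
    funext fun i => (mix_wf hc (d i) w).symm
  rw [hinv]
  refine ⟨fun i => ?_, ⟨g, hg, huniq⟩, hproper, ?_, fun e he hfe => ?_⟩
  · have hi : wfComp (cauchyInv d) c i [] = _ := coeff_nil_wf hc (d i)⁻¹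
    rw [hi, MvPowerSeries.constantCoeff_inv]
    exact inv_ne_zero (hd i)
  · exact congrArg (mixComp c) ((hwf g).trans hfix)
  · -- The series `d ⋄ e` is a fixed point of `w ↦ h ∘̃ δ_w`, so it is `g`.
    have hfe' : mixComp c (wfComp d e) = e := hfe
    have hw := hwf (wfComp d e)
    rw [hfe'] at hw
    have hdg : wfComp d e = g := (existsUnique_mix_fixedPoint h).unique hw.symm hfix
    rw [← hdg, hfe']
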